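/- Let $K,d\ge 1$ be integers, let $U\subset\mathbf R^{n_u}$ and $V\subset\mathbf R^{n_v}$ be nonempty convex compact sets, let $A\in\mathbf R^{d\times n_u}$, $a\in\mathbf R^d$, $g\in\mathbf R^{n_u}$, $c\in\mathbf R$, let $v\mapsto M(v)$ be an affine map from $\mathbf R^{n_v}$ into the real $d\times d$ matrices such that $M(v)$ is symmetric positive definite for every $v\in V$, and let $\epsilon\in(0,1)$. For $\theta\in\mathbf R^d$ and a $d\times d$ matrix $\Theta\succeq0$, let $\mathcal{SG}(\theta,\Theta)$ be the family of Borel probability distributions $P$ on $\mathbf R^d$ such that $\ln\mathbf E_{\zeta\sim P}\{e^{f^T\zeta}\}\le f^T\theta+\tfrac12 f^T\Theta f$ for all $f\in\mathbf R^d$. For a Borel function (an estimate) $\widehat g:(\mathbf R^d)^K\to\mathbf R$, let $\mathrm{Risk}_\epsilon(\widehat g)$ be the infimum of those $\rho$ for which $$\mathrm{Prob}_{\omega^K\sim P^K}\left\{\omega^K:|\widehat g(\omega^K)-(g^Tu+c)|>\rho\right\}\le\epsilon\qquad\text{for all }u\in U,\ v\in V,\ P\in\mathcal{SG}(Au+a,M(v))$$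 ($+\infty$ if there is no such $\rho$), and let $\mathrm{Risk}^{\mathrm{opt}}_\epsilon(K)=\inf_{\widehat g}\mathrm{Risk}_\epsilon(\widehat g)$, the infimum being taken over all Borel estimates. Let $\phi_U(h)=\max_{u\in U}u^Th$ and $$\mathrm{Opt}=\min_{f\in\mathbf R^d}\left\{\tfrac12\left[\phi_U(A^Tf-g)+\phi_U(-A^Tf+g)\right]+\max_{v\in V}\left[2K^{-1}\ln(2/\epsilon)\,f^TM(v)f\right]^{1/2}\right\}.\qquad(*)$$ Then the minimum in $(*)$ is attained, and for every optimal solution $f_*$ the affine estimate $$\widehat g_*(\omega^K)=\frac1K\sum_{i=1}^Kf_*^T\omega_i+\varkappa_*,\qquad \varkappa_*=\tfrac12\left[\phi_U(-A^Tf_*+g)-\phi_U(A^Tf_*-g)\right]-a^Tf_*+c,$$ satisfies $\mathrm{Risk}_\epsilon(\widehat g_*)\le\mathrm{Opt}$. If moreover $\epsilon<\tfrac12$, then $$\mathrm{Opt}\le\frac{\sqrt{2\ln(2/\epsilon)}}{q_{\mathcal N}(1-\epsilon)}\,\mathrm{Risk}^{\mathrm{opt}}_\epsilon(K),$$ where $q_{\mathcal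 N}(s)$ is the $s$-quantile of the standard normal distribution. Finally, $\sqrt{2\ln(2/\epsilon)}/q_{\mathcal N}(1-\epsilon)\to1$ as $\epsilon\to0^+$. -/

import Mathlib

open MeasureTheory ProbabilityTheory Filter Topology Matrix

namespace LinearFormRecovery

noncomputable section

/-- `P ∈ SG(θ, Θ)`: `P` is a Borel probability distribution on `ℝ^d` such that for every `f` one has
`ln E exp(fᵀζ) ≤ fᵀθ + ½ fᵀΘf`. The integrability clause says that the expectation is finite, as it
must be when its logarithm is bounded by a real number. -/
def IsSubGaussian {d : ℕ} (θ : Fin d → ℝ) (Θ : Matrix (Fin d) (Fin d) ℝ)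
    (P : Measure (Fin d → ℝ)) : Prop :=
  IsProbabilityMeasure P ∧
    ∀ f : Fin d → ℝ,
      Integrable (fun ζ : Fin d → ℝ => Real.exp (f ⬝ᵥ ζ)) P ∧
      Real.log (∫ ζ, Real.exp (f ⬝ᵥ ζ) ∂P) ≤ f ⬝ᵥ θ + (1 / 2) * (f ⬝ᵥ (Θ *ᵥ f))

/-- The estimate `ghat` of `gᵀu + c` built upon `K` i.i.d. observations is `(ρ, ε)`-accurate: whenever
`(u, v) ∈ U × V` and the common distribution `P` of the observations is sub-Gaussian with parameters
`(Au + a, M(v))`, the recovery error exceeds `ρ` with `P^K`-probability at most `ε`. -/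
def IsAccurate {K d nu nv : ℕ} (U : Set (Fin nu → ℝ)) (V : Set (Fin nv → ℝ))
    (A : Matrix (Fin d) (Fin nu) ℝ) (a : Fin d → ℝ)
    (M : (Fin nv → ℝ) →ᵃ[ℝ] Matrix (Fin d) (Fin d) ℝ) (g : Fin nu → ℝ) (c ε : ℝ)
    (ghat : (Fin K → Fin d → ℝ) → ℝ) (ρ : ℝ) : Prop :=
  ∀ u ∈ U, ∀ v ∈ V, ∀ P : Measure (Fin d → ℝ), IsSubGaussian (A *ᵥ u + a) (M v) P →
    Measure.pi (fun _ : Fin K => P) {ω | ρ < |ghat ω - (g ⬝ᵥ u + c)|} ≤ ENNReal.ofReal ε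

/-- The `ε`-risk of an estimate: the infimum of those `ρ` for which it is `(ρ, ε)`-accurate
(`⊤` when there is no such `ρ`). -/
def epsRisk {K d nu nv : ℕ} (U : Set (Fin nu → ℝ)) (V : Set (Fin nv → ℝ))
    (A : Matrix (Fin d) (Fin nu) ℝ) (a : Fin d → ℝ)
    (M : (Fin nv → ℝ) →ᵃ[ℝ] Matrix (Fin d) (Fin d) ℝ) (g : Fin nu → ℝ) (c ε : ℝ)
    (ghat : (Fin K → Fin d → ℝ) → ℝ) : EReal :=
  ⨅ (ρ : ℝ) (_ : IsAccurate U V A a M g c ε ghat ρ), (ρ : EReal)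

/-- The minimax optimal `ε`-risk: the infimum of the `ε`-risks of all Borel estimates. -/
def minimaxRisk (K : ℕ) {d nu nv : ℕ} (U : Set (Fin nu → ℝ)) (V : Set (Fin nv → ℝ))
    (A : Matrix (Fin d) (Fin nu) ℝ) (a : Fin d → ℝ)
    (M : (Fin nv → ℝ) →ᵃ[ℝ] Matrix (Fin d) (Fin d) ℝ) (g : Fin nu → ℝ) (c ε : ℝ) : EReal :=
  ⨅ (ghat : (Fin K → Fin d → ℝ) → ℝ) (_ : Measurable ghat), epsRisk U V A a M g c ε ghat

/-- The support function `φ_U(h) = max_{u ∈ U} uᵀh`. -/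
def supportFn {n : ℕ} (U : Set (Fin n → ℝ)) (h : Fin n → ℝ) : ℝ :=
  sSup ((fun u => u ⬝ᵥ h) '' U)

/-- The objective
`½[φ_U(Aᵀf - g) + φ_U(-Aᵀf + g)] + max_{v ∈ V} [2 K⁻¹ ln(2/ε) fᵀM(v)f]^{1/2}`. -/
def objective (K : ℕ) {d nu nv : ℕ} (U : Set (Fin nu → ℝ)) (V : Set (Fin nv → ℝ))
    (A : Matrix (Fin d) (Fin nu) ℝ) (M : (Fin nv → ℝ) →ᵃ[ℝ] Matrix (Fin d) (Fin d) ℝ)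
    (g : Fin nu → ℝ) (ε : ℝ) (f : Fin d → ℝ) : ℝ :=
  (1 / 2) * (supportFn U (Aᵀ *ᵥ f - g) + supportFn U (-(Aᵀ *ᵥ f) + g)) +
    sSup ((fun v => Real.sqrt (2 * (K : ℝ)⁻¹ * Real.log (2 / ε) * (f ⬝ᵥ (M v *ᵥ f)))) '' V)

/-- The optimal value `Opt` of the problem of minimizing the objective over `f ∈ ℝ^d`. -/
def Opt (K : ℕ) {d nu nv : ℕ} (U : Set (Fin nu → ℝ)) (V : Set (Fin nv → ℝ))
    (A : Matrix (Fin d) (Fin nu) ℝ) (M : (Fin nv → ℝ) →ᵃ[ℝ] Matrix (Fin d) (Fin d) ℝ)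
    (g : Fin nu → ℝ) (ε : ℝ) : ℝ :=
  ⨅ f : Fin d → ℝ, objective K U V A M g ε f

/-- The affine estimate `K⁻¹ ∑ᵢ fᵀωᵢ + ϰ` with
`ϰ = ½[φ_U(-Aᵀf + g) - φ_U(Aᵀf - g)] - aᵀf + c` induced by `f`. -/
def affineEstimate {K d nu : ℕ} (U : Set (Fin nu → ℝ))
    (A : Matrix (Fin d) (Fin nu) ℝ) (a : Fin d → ℝ) (g : Fin nu → ℝ) (c : ℝ)
    (f : Fin d → ℝ) (ω : Fin K → Fin d → ℝ) : ℝ :=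
  (K : ℝ)⁻¹ * ∑ i, f ⬝ᵥ ω i +
    ((1 / 2) * (supportFn U (-(Aᵀ *ᵥ f) + g) - supportFn U (Aᵀ *ᵥ f - g)) - a ⬝ᵥ f + c)

/-- The `s`-quantile of the standard normal distribution. -/
def normalQuantile (s : ℝ) : ℝ :=
  sInf {x : ℝ | s ≤ cdf (gaussianReal 0 1) x}

/-- The near-optimality factor `√(2 ln(2/ε)) / q_N(1 - ε)`. -/
def nearOptFactor (ε : ℝ) : ℝ :=
  Real.sqrt (2 * Real.log (2 / ε)) / normalQuantile (1 - ε)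

end

end LinearFormRecovery

open LinearFormRecovery

namespace LinearFormRecovery

/-! ### Standard normal distribution -/

/-! Upper bound. For any `f`, the error of the affine estimate is a centred average plus a bias. The
constant `ϰ` balances the extreme biases over `U`, leaving half the sum of the two support
functions. The average is sub-Gaussian with variance proxy `fᵀM(v)f / K`, so Chernoff with `ε/2` per
tail gives the square-root term (`isAccurate_affineEstimate`). A minimizer exists because the
objective is lower semicontinuous and coercive, `M(v)` being positive definite.

Lower bound. The objective is the maximum over `(u₁, u₂, v)` of the convex-concave `payoff`, so
minimax (`exists_saddle`) provides one triple whose payoff is at least `Opt` for every `f`. Taking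
`f = 0` gives `Opt ≤ ½ gᵀ(u₂ - u₁)`; boundedness below along rays gives `½ A(u₁ - u₂) = γ z` with `z
zᵀ ⪯ M(v)` and `γ² = 2 K⁻¹ ln(2/ε)`. Shrink the segment about its midpoint by a factor `t`, and at
its ends take Gaussian laws carried by a line of direction `z`. Telling them apart means testing
`N(tγ, 1)` against `N(-tγ, 1)` from `K` samples, with error sum above `2ε` as long as `tγ√K` is
below the normal quantile (`two_mul_one_sub_cdf_le`). Hence `t * Opt ≤ ρ` for every accuracy `ρ`
that an estimate attains; let `t` tend to its critical value.

The factor tends to `1` because elementary Gaussian tail bounds put the quantile within a bounded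
distance of `√(2 ln(1/ε))`. -/

theorem gaussianReal_real_Iic_add_real_Iic_neg (x : ℝ) :
    (gaussianReal 0 1).real (Set.Iic x) + (gaussianReal 0 1).real (Set.Iic (-x)) = 1 := by
  have : NullSingletonClass (gaussianReal 0 1) := nullSingletonClass_gaussianReal one_ne_zero
  have h1 : (gaussianReal 0 1).real (Set.Iic (-x)) = (gaussianReal 0 1).real (Set.Ioi x) := by
    have h2 : (gaussianReal 0 1).map (fun x => -x) = gaussianReal 0 1 := by
      simp [gaussianReal_map_neg]
    calc (gaussianReal 0 1).real (Set.Iic (-x))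
        = ((gaussianReal 0 1).map (fun x => -x)).real (Set.Iic (-x)) := by rw [h2]
      _ = (gaussianReal 0 1).real (Set.Ici x) := by
        rw [map_measureReal_apply (by fun_prop) measurableSet_Iic]
        congr 1; ext y; simp
      _ = _ := measureReal_congr Ioi_ae_eq_Ici.symm
  rw [h1, ← Set.compl_Iic, probReal_compl_eq_one_sub measurableSet_Iic]
  ring

theorem cdf_gaussianReal_neg (x : ℝ) :
    cdf (gaussianReal 0 1) (-x) = 1 - cdf (gaussianReal 0 1) x := by
  have := gaussianReal_real_Iic_add_real_Iic_neg x
  rw [cdf_eq_real, cdf_eq_real]; linarith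

theorem hasSubgaussianMGF_id_gaussianReal : HasSubgaussianMGF id 1 (gaussianReal 0 1) where
  integrable_exp_mul t := integrable_exp_mul_gaussianReal t
  mgf_le t := by rw [mgf_id_gaussianReal]; simp

theorem one_sub_cdf_gaussianReal_le {x : ℝ} (hx : 0 ≤ x) :
    1 - cdf (gaussianReal 0 1) x ≤ Real.exp (-x ^ 2 / 2) := by
  rw [cdf_eq_real, ← probReal_compl_eq_one_sub measurableSet_Iic]
  refine (measureReal_mono ?_).trans
    ((hasSubgaussianMGF_id_gaussianReal.measure_ge_le hx).trans_eq (by simp))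
  intro y hy
  rw [Set.mem_compl_iff, Set.mem_Iic, not_le] at hy
  exact hy.le

/-- The density decreases on `(x, x + 1]`, so the mass of this unit interval is at least the density
at its right end. This crude bound suffices for the asymptotics. -/
theorem le_one_sub_cdf_gaussianReal {x : ℝ} (hx : 0 ≤ x) :
    (√(2 * Real.pi))⁻¹ * Real.exp (-(x + 1) ^ 2 / 2) ≤ 1 - cdf (gaussianReal 0 1) x := by
  rw [cdf_eq_real, ← probReal_compl_eq_one_sub measurableSet_Iic]
  have h1 : Set.Ioc x (x + 1) ⊆ (Set.Iic x)ᶜ := fun y hy => by simpa using hy.1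
  refine le_trans ?_ (measureReal_mono h1)
  rw [measureReal_def, gaussianReal_apply_eq_integral _ one_ne_zero, ENNReal.toReal_ofReal
    (setIntegral_nonneg measurableSet_Ioc fun y _ => gaussianPDFReal_nonneg _ _ _)]
  have h2 : (√(2 * Real.pi))⁻¹ * Real.exp (-(x + 1) ^ 2 / 2)
      = ∫ _ in Set.Ioc x (x + 1), (√(2 * Real.pi))⁻¹ * Real.exp (-(x + 1) ^ 2 / 2) := by
    simp
  rw [h2]
  refine setIntegral_mono_on (integrableOn_const (by simp)) (integrable_gaussianPDFReal 0 1).integrableOn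
    measurableSet_Ioc fun y hy => ?_
  rw [gaussianPDFReal_def]
  simp only [NNReal.coe_one, mul_one, sub_zero]
  gcongr
  · linarith [hy.1]
  · exact hy.2

/-! ### The normal quantile: attainment and two-sided bounds -/

theorem bddBelow_setOf_le_cdf {μ : Measure ℝ} {s : ℝ} (hs : 0 < s) :
    BddBelow {x : ℝ | s ≤ cdf μ x} := by
  obtain ⟨b, hb⟩ := ((tendsto_cdf_atBot μ).eventually (gt_mem_nhds hs)).exists
  refine ⟨b, fun x hx => ?_⟩
  by_contra! h
  exact absurd (hx.trans ((monotone_cdf μ) h.le)) (not_le.2 hb)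

theorem nonempty_setOf_le_cdf {μ : Measure ℝ} {s : ℝ} (hs : s < 1) :
    {x : ℝ | s ≤ cdf μ x}.Nonempty := by
  obtain ⟨b, hb⟩ := ((tendsto_cdf_atTop μ).eventually (lt_mem_nhds hs)).exists
  exact ⟨b, hb.le⟩

theorem normalQuantile_le {s x : ℝ} (hs : 0 < s) (hx : s ≤ cdf (gaussianReal 0 1) x) :
    normalQuantile s ≤ x :=
  csInf_le (bddBelow_setOf_le_cdf hs) hx

theorem cdf_lt_of_lt_normalQuantile {s x : ℝ} (hs : 0 < s) (hx : x < normalQuantile s) :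
    cdf (gaussianReal 0 1) x < s := by
  by_contra! h
  exact absurd (normalQuantile_le hs h) (not_le.2 hx)

/-- Right continuity of the cdf makes the infimum defining the quantile attained. -/
theorem le_cdf_normalQuantile {s : ℝ} (hs1 : s < 1) :
    s ≤ cdf (gaussianReal 0 1) (normalQuantile s) := by
  have h1 : Tendsto (cdf (gaussianReal 0 1)) (𝓝[>] (normalQuantile s))
      (𝓝 (cdf (gaussianReal 0 1) (normalQuantile s))) :=
    (((cdf (gaussianReal 0 1)).right_continuous _).mono Set.Ioi_subset_Ici_self)
  refine ge_of_tendsto h1 ?_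
  filter_upwards [self_mem_nhdsWithin] with y hy
  obtain ⟨z, hz, hzy⟩ := exists_lt_of_csInf_lt (nonempty_setOf_le_cdf hs1) hy
  exact le_trans hz (monotone_cdf _ hzy.le)

theorem normalQuantile_pos {ε : ℝ} (h0 : 0 < ε) (h : ε < 1 / 2) : 0 < normalQuantile (1 - ε) := by
  by_contra! hq
  have h1 := (le_cdf_normalQuantile (s := 1 - ε) (by linarith)).trans (monotone_cdf _ hq)
  have h2 := cdf_gaussianReal_neg 0
  rw [neg_zero] at h2
  linarith

theorem normalQuantile_one_sub_le {ε : ℝ} (h0 : 0 < ε) (h1 : ε < 1) :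
    normalQuantile (1 - ε) ≤ √(2 * Real.log (1 / ε)) := by
  refine normalQuantile_le (by linarith) ?_
  have h2 := one_sub_cdf_gaussianReal_le (Real.sqrt_nonneg (2 * Real.log (1 / ε)))
  have h3 : 0 ≤ Real.log (1 / ε) := Real.log_nonneg (by rw [le_div_iff₀ h0]; linarith)
  rw [Real.sq_sqrt (by positivity), neg_div, mul_div_cancel_left₀ _ two_ne_zero, one_div,
    Real.log_inv, neg_neg, Real.exp_log h0] at h2
  rw [one_div, Real.log_inv]
  linarith

theorem le_normalQuantile_one_sub {ε : ℝ} (h0 : 0 < ε) (h : ε < 1 / 2) :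
    √(2 * Real.log (1 / (ε * √(2 * Real.pi)))) - 1 ≤ normalQuantile (1 - ε) := by
  have hq := normalQuantile_pos h0 h
  have h1 := le_cdf_normalQuantile (s := 1 - ε) (by linarith)
  have h2 := le_one_sub_cdf_gaussianReal hq.le
  set q := normalQuantile (1 - ε)
  have hpi : 0 < √(2 * Real.pi) := by positivity
  have h3 : Real.exp (-(q + 1) ^ 2 / 2) ≤ ε * √(2 * Real.pi) := by
    have : (√(2 * Real.pi))⁻¹ * Real.exp (-(q + 1) ^ 2 / 2) ≤ ε := by linarith
    rwa [inv_mul_le_iff₀ hpi, mul_comm] at this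
  rw [sub_le_iff_le_add]
  refine Real.sqrt_le_iff.2 ⟨by linarith, ?_⟩
  rw [one_div, Real.log_inv]
  have h4 := (Real.le_log_iff_exp_le (by positivity)).2 h3
  linarith

/-! ### Limit of the near-optimality factor -/

theorem tendsto_sqrt_ratio (a b c : ℝ) :
    Tendsto (fun L : ℝ => √(2 * (L + a)) / (√(2 * (L + b)) - c)) atTop (𝓝 1) := by
  have key (a : ℝ) : Tendsto (fun L : ℝ => √(2 * (L + a)) / √L) atTop (𝓝 (√2)) := by
    have h1 : Tendsto (fun L : ℝ => √(2 * (1 + a / L))) atTop (𝓝 (√(2 * (1 + 0)))) :=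
      ((tendsto_const_nhds.add (tendsto_const_nhds.div_atTop tendsto_id)).const_mul 2).sqrt
    rw [add_zero, mul_one] at h1
    refine h1.congr' ?_
    filter_upwards [eventually_gt_atTop 0] with L hL
    rw [← Real.sqrt_div' _ hL.le]
    congr 1
    field_simp
  have h2 : Tendsto (fun L : ℝ => c / √L) atTop (𝓝 0) :=
    tendsto_const_nhds.div_atTop Real.tendsto_sqrt_atTop
  have h3 := (key a).div ((key b).sub h2) (by simp)
  rw [sub_zero, div_self (by simp)] at h3
  refine h3.congr' ?_
  filter_upwards [eventually_gt_atTop 0] with L hL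
  have : √L ≠ 0 := (Real.sqrt_pos.2 hL).ne'
  simp only [Pi.div_apply]
  rw [← sub_div, div_div_div_cancel_right₀ this]

theorem tendsto_nearOptFactor : Tendsto nearOptFactor (𝓝[>] 0) (𝓝 1) := by
  -- In the variable `L = -log ε` both quantile bounds turn the factor into ratios covered by
  -- `tendsto_sqrt_ratio`, and a squeeze finishes.
  have hL : Tendsto (fun ε : ℝ => -Real.log ε) (𝓝[>] 0) atTop :=
    tendsto_neg_atBot_atTop.comp Real.tendsto_log_nhdsGT_zero
  have h1 := (tendsto_sqrt_ratio (Real.log 2) 0 0).comp hL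
  have h2 := (tendsto_sqrt_ratio (Real.log 2) (-Real.log (√(2 * Real.pi))) 1).comp hL
  have hs : 0 < √(2 * Real.pi) := by positivity
  have hbig : ∀ᶠ L : ℝ in atTop, 0 < √(2 * (L + -Real.log (√(2 * Real.pi)))) - 1 := by
    have : Tendsto (fun L : ℝ => √(2 * (L + -Real.log (√(2 * Real.pi))))) atTop atTop :=
      Real.tendsto_sqrt_atTop.comp
        ((tendsto_atTop_add_const_right _ _ tendsto_id).const_mul_atTop two_pos)
    filter_upwards [this.eventually_gt_atTop 1] with L hL using by linarith
  have hsmall : ∀ᶠ ε : ℝ in 𝓝[>] 0, 0 < ε ∧ ε < 1 / 2 :=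
    Ioo_mem_nhdsGT (by norm_num)
  refine tendsto_of_tendsto_of_tendsto_of_le_of_le' h1 h2 ?_ ?_
  · filter_upwards [hsmall] with ε hε
    have hq := normalQuantile_pos hε.1 hε.2
    have hle := normalQuantile_one_sub_le hε.1 (by linarith [hε.2])
    simp only [Function.comp_apply, nearOptFactor, Real.log_div two_ne_zero hε.1.ne', add_zero,
      sub_zero]
    rw [one_div, Real.log_inv] at hle
    rw [neg_add_eq_sub]
    gcongr
  · filter_upwards [hsmall, hL.eventually hbig] with ε hε hb
    have hle := le_normalQuantile_one_sub hε.1 hε.2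
    simp only [Function.comp_apply, nearOptFactor, Real.log_div two_ne_zero hε.1.ne']
    rw [one_div, Real.log_inv, Real.log_mul hε.1.ne' hs.ne', neg_add] at hle
    rw [neg_add_eq_sub]
    gcongr

section AffineRisk

/-! ### Upper bound on the risk of affine estimates -/

/-- The definition applied to `t • f` for all real `t` is a scalar MGF bound, once the mean term is
moved to the other side. -/
theorem IsSubGaussian.hasSubgaussianMGF {d : ℕ} {θ : Fin d → ℝ} {Θ : Matrix (Fin d) (Fin d) ℝ}
    {P : Measure (Fin d → ℝ)} (hP : IsSubGaussian θ Θ P) (f : Fin d → ℝ) {q : NNReal}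
    (hq : f ⬝ᵥ (Θ *ᵥ f) = q) :
    HasSubgaussianMGF (fun ζ => f ⬝ᵥ ζ - f ⬝ᵥ θ) q P := by
  have := hP.1
  have hfun (t : ℝ) : (fun ζ : Fin d → ℝ => Real.exp (t * (f ⬝ᵥ ζ - f ⬝ᵥ θ)))
      = fun ζ => Real.exp (-(t * f ⬝ᵥ θ)) * Real.exp ((t • f) ⬝ᵥ ζ) := by
    ext ζ
    rw [← Real.exp_add, smul_dotProduct, smul_eq_mul]
    ring_nf
  refine ⟨fun t => ?_, fun t => ?_⟩
  · rw [hfun]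
    exact (hP.2 (t • f)).1.const_mul _
  · rw [mgf, hfun, integral_const_mul]
    have h1 := (hP.2 (t • f)).2
    rw [Real.log_le_iff_le_exp (integral_exp_pos (hP.2 (t • f)).1)] at h1
    calc _ ≤ Real.exp (-(t * f ⬝ᵥ θ))
          * Real.exp ((t • f) ⬝ᵥ θ + 1 / 2 * ((t • f) ⬝ᵥ (Θ *ᵥ (t • f)))) := by gcongr
      _ = _ := by
        rw [← Real.exp_add, mulVec_smul, smul_dotProduct, smul_dotProduct, dotProduct_smul, hq]
        simp only [smul_eq_mul]
        ring_nf

theorem measure_pi_abs_sum_gt_le {K d : ℕ} (hK : 0 < K) {θ : Fin d → ℝ}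
    {Θ : Matrix (Fin d) (Fin d) ℝ} (hΘ : Θ.PosDef) {P : Measure (Fin d → ℝ)}
    (hP : IsSubGaussian θ Θ P) (f : Fin d → ℝ) {ε : ℝ} (h0 : 0 < ε) (h1 : ε < 1) :
    Measure.pi (fun _ : Fin K => P)
      {ω | √(2 * (K : ℝ)⁻¹ * Real.log (2 / ε) * (f ⬝ᵥ (Θ *ᵥ f)))
        < |(K : ℝ)⁻¹ * ∑ i, (f ⬝ᵥ ω i - f ⬝ᵥ θ)|} ≤ ENNReal.ofReal ε := by
  have := hP.1
  have hL : 0 < Real.log (2 / ε) := Real.log_pos (by rw [lt_div_iff₀ h0]; linarith)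
  -- For `f = 0` the variance proxy vanishes and the Chernoff exponent below would be `0 / 0`; here
  -- the event is simply empty.
  rcases eq_or_ne f 0 with rfl | hf
  · simp
  have hq : 0 < f ⬝ᵥ (Θ *ᵥ f) := by simpa using hΘ.dotProduct_mulVec_pos hf
  obtain ⟨q, hq'⟩ : ∃ q : NNReal, f ⬝ᵥ (Θ *ᵥ f) = q := ⟨⟨_, hq.le⟩, rfl⟩
  rw [hq'] at hq ⊢
  have hK' : (0 : ℝ) < K := by exact_mod_cast hK
  have hX := hP.hasSubgaussianMGF f hq'
  have hsum : HasSubgaussianMGF (fun ω : Fin K → Fin d → ℝ => ∑ i, (f ⬝ᵥ ω i - f ⬝ᵥ θ))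
      (∑ _i : Fin K, q) (Measure.pi fun _ => P) := by
    refine HasSubgaussianMGF.sum_of_iIndepFun
      (iIndepFun_pi (μ := fun _ : Fin K => P) (X := fun _ ζ => f ⬝ᵥ ζ - f ⬝ᵥ θ)
        fun _ => hX.aemeasurable) fun i _ => ?_
    refine HasSubgaussianMGF.of_map (X := fun ζ => f ⬝ᵥ ζ - f ⬝ᵥ θ)
      (Y := fun ω : Fin K → Fin d → ℝ => ω i) (measurable_pi_apply i).aemeasurable ?_
    rwa [(measurePreserving_eval (fun _ : Fin K => P) i).map_eq]
  set r := √(2 * (K : ℝ)⁻¹ * Real.log (2 / ε) * q) with hr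
  have hr2 : r ^ 2 = 2 * (K : ℝ)⁻¹ * Real.log (2 / ε) * q := Real.sq_sqrt (by positivity)
  -- The threshold `r` is tuned so that each one-sided tail costs exactly `ε / 2`.
  have hexp : Real.exp (-(K * r) ^ 2 / (2 * (∑ _i : Fin K, q : NNReal))) = ε / 2 := by
    rw [mul_pow, hr2]
    have : -((K : ℝ) ^ 2 * (2 * (K : ℝ)⁻¹ * Real.log (2 / ε) * q))
        / (2 * ((∑ _i : Fin K, q : NNReal) : ℝ)) = - Real.log (2 / ε) := by
      simp only [Finset.sum_const, Finset.card_univ, Fintype.card_fin, nsmul_eq_mul,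
        NNReal.coe_mul, NNReal.coe_natCast]
      field_simp
    rw [this, ← Real.log_inv, Real.exp_log (by positivity), inv_div]
  have hr0 : 0 ≤ K * r := by positivity
  have ha := hsum.measure_ge_le hr0
  have hb := hsum.neg.measure_ge_le hr0
  rw [hexp] at ha hb
  rw [← ofReal_measureReal]
  refine ENNReal.ofReal_le_ofReal (le_trans (measureReal_mono ?_)
    ((measureReal_union_le _ _).trans ((add_le_add ha hb).trans_eq (add_halves ε))))
  intro ω hω
  simp only [Set.mem_ofPred_eq, Set.mem_union, Pi.neg_apply] at hω ⊢
  rw [abs_mul, abs_of_pos (inv_pos.2 hK'), lt_inv_mul_iff₀ hK', lt_abs] at hω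
  exact hω.imp le_of_lt le_of_lt

theorem dotProduct_le_supportFn {n : ℕ} {U : Set (Fin n → ℝ)} (hU : IsCompact U)
    {u : Fin n → ℝ} (hu : u ∈ U) (h : Fin n → ℝ) : u ⬝ᵥ h ≤ supportFn U h :=
  le_csSup (hU.image (by fun_prop)).bddAbove ⟨u, hu, rfl⟩

theorem exists_dotProduct_eq_supportFn {n : ℕ} {U : Set (Fin n → ℝ)} (hU : IsCompact U)
    (hne : U.Nonempty) (h : Fin n → ℝ) : ∃ u ∈ U, u ⬝ᵥ h = supportFn U h :=
  (hU.image (f := fun u => u ⬝ᵥ h) (by fun_prop)).sSup_mem (hne.image _)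

variable {K d nu nv : ℕ} {U : Set (Fin nu → ℝ)} {V : Set (Fin nv → ℝ)}
  {A : Matrix (Fin d) (Fin nu) ℝ} {M : (Fin nv → ℝ) →ᵃ[ℝ] Matrix (Fin d) (Fin d) ℝ}
  {g : Fin nu → ℝ} {ε : ℝ}

theorem continuous_stdDev (M : (Fin nv → ℝ) →ᵃ[ℝ] Matrix (Fin d) (Fin d) ℝ) (C : ℝ) :
    Continuous fun p : (Fin d → ℝ) × (Fin nv → ℝ) => √(C * (p.1 ⬝ᵥ (M p.2 *ᵥ p.1))) := by
  have hM : Continuous M := by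
    rw [M.decomp]
    exact M.linear.continuous_of_finiteDimensional.add continuous_const
  fun_prop

theorem stdDev_le_sSup (hV : IsCompact V) {v : Fin nv → ℝ} (hv : v ∈ V) (C : ℝ) (f : Fin d → ℝ) :
    √(C * (f ⬝ᵥ (M v *ᵥ f))) ≤ sSup ((fun v => √(C * (f ⬝ᵥ (M v *ᵥ f)))) '' V) := by
  refine le_csSup (hV.image ?_).bddAbove ⟨v, hv, rfl⟩
  exact (continuous_stdDev M C).comp (by fun_prop : Continuous fun v => (f, v))

theorem isAccurate_affineEstimate (hK : 0 < K) (hU : IsCompact U) (hV : IsCompact V)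
    (hM : ∀ v ∈ V, (M v).PosDef) (a : Fin d → ℝ) (c : ℝ) (h0 : 0 < ε) (h1 : ε < 1)
    (f : Fin d → ℝ) :
    IsAccurate (K := K) U V A a M g c ε (affineEstimate U A a g c f)
      (objective K U V A M g ε f) := by
  intro u hu v hv P hP
  refine (measure_mono ?_).trans (measure_pi_abs_sum_gt_le hK (hM v hv) hP f h0 h1)
  intro ω hω
  simp only [Set.mem_ofPred_eq] at hω ⊢
  have hK' : (K : ℝ) ≠ 0 := by exact_mod_cast hK.ne'
  have e1 := dotProduct_le_supportFn hU hu (Aᵀ *ᵥ f - g)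
  have e2 := dotProduct_le_supportFn hU hu (-(Aᵀ *ᵥ f) + g)
  have e3 := stdDev_le_sSup (M := M) hV hv (2 * (K : ℝ)⁻¹ * Real.log (2 / ε)) f
  rw [objective] at hω
  have e4 : u ⬝ᵥ (Aᵀ *ᵥ f) = f ⬝ᵥ (A *ᵥ u) := by
    rw [mulVec_transpose, dotProduct_comm, ← dotProduct_mulVec]
  -- Error = centred noise + bias; with `e1` and `e2`, the bias has absolute value at most half the
  -- sum of the two support functions.
  have e5 : affineEstimate U A a g c f ω - (g ⬝ᵥ u + c)
      = (K : ℝ)⁻¹ * ∑ i, (f ⬝ᵥ ω i - f ⬝ᵥ (A *ᵥ u + a)) + (u ⬝ᵥ (Aᵀ *ᵥ f - g) +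
        (1 / 2) * (supportFn U (-(Aᵀ *ᵥ f) + g) - supportFn U (Aᵀ *ᵥ f - g))) := by
    have e6 (y : ℝ) : (K : ℝ)⁻¹ * (K * y) = y := inv_mul_cancel_left₀ hK' y
    rw [affineEstimate, Finset.sum_sub_distrib, Finset.sum_const, Finset.card_univ,
      Fintype.card_fin, nsmul_eq_mul, mul_sub (K : ℝ)⁻¹, e6, dotProduct_add,
      dotProduct_sub, e4, dotProduct_comm a f, dotProduct_comm u g]
    ring
  rw [dotProduct_add, dotProduct_neg] at e2
  rw [dotProduct_sub] at e1
  rw [e5] at hω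
  by_contra! hle
  have e6 := abs_le.1 (hle.trans e3)
  refine absurd hω (not_lt.2 (abs_le.2 ⟨?_, ?_⟩)) <;> rw [dotProduct_sub] <;> linarith [e6.1, e6.2]

theorem epsRisk_affineEstimate_le (hK : 0 < K) (hU : IsCompact U) (hV : IsCompact V)
    (hM : ∀ v ∈ V, (M v).PosDef) (a : Fin d → ℝ) (c : ℝ) (h0 : 0 < ε) (h1 : ε < 1)
    (f : Fin d → ℝ) :
    epsRisk (K := K) U V A a M g c ε (affineEstimate U A a g c f)
      ≤ ((objective K U V A M g ε f : ℝ) : EReal) :=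
  iInf₂_le _ (isAccurate_affineEstimate hK hU hV hM a c h0 h1 f)

end AffineRisk

/-! ### A two-point lower bound for Gaussian shifts -/

theorem gaussianReal_eq_withDensity_neg (s : ℝ) :
    gaussianReal s 1
      = (gaussianReal (-s) 1).withDensity fun x => ENNReal.ofReal (Real.exp (2 * s * x)) := by
  rw [gaussianReal_of_var_ne_zero s one_ne_zero, gaussianReal_of_var_ne_zero (-s) one_ne_zero,
    ← withDensity_mul _ (measurable_gaussianPDF _ _) (by fun_prop)]
  congr 1
  ext x
  simp only [Pi.mul_apply, gaussianPDF_def]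
  rw [← ENNReal.ofReal_mul (gaussianPDFReal_nonneg _ _ _), gaussianPDFReal_def,
    gaussianPDFReal_def]
  dsimp only
  rw [mul_assoc _ (Real.exp _), ← Real.exp_add]
  congr 3
  push_cast
  ring

theorem pi_gaussianReal_eq_withDensity_neg (ι : Type*) [Fintype ι] (s : ℝ) :
    Measure.pi (fun _ : ι => gaussianReal s 1)
      = (Measure.pi fun _ : ι => gaussianReal (-s) 1).withDensity
        fun x => ENNReal.ofReal (Real.exp (2 * s * ∑ i, x i)) := by
  refine Measure.pi_eq fun B hB => ?_
  rw [withDensity_apply _ (MeasurableSet.univ_pi hB),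
    ← lintegral_indicator (MeasurableSet.univ_pi hB)]
  have hm (i : ι) : Measurable ((B i).indicator
      fun y => ENNReal.ofReal (Real.exp (2 * s * y))) :=
    Measurable.indicator (by fun_prop) (hB i)
  have h1 (x : ι → ℝ) : (Set.univ.pi B).indicator
        (fun x => ENNReal.ofReal (Real.exp (2 * s * ∑ i, x i))) x
      = ∏ i, (B i).indicator (fun y => ENNReal.ofReal (Real.exp (2 * s * y))) (x i) := by
    by_cases hx : x ∈ Set.univ.pi B
    · rw [Set.indicator_of_mem hx, Finset.mul_sum, Real.exp_sum,
        ENNReal.ofReal_prod_of_nonneg fun _ _ => (Real.exp_pos _).le]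
      exact Finset.prod_congr rfl fun i _ => by
        rw [Set.indicator_of_mem (hx i trivial)]
    · rw [Set.indicator_of_notMem hx]
      simp only [Set.mem_pi, Set.mem_univ, true_imp_iff, not_forall] at hx
      obtain ⟨i, hi⟩ := hx
      exact (Finset.prod_eq_zero (Finset.mem_univ i) (Set.indicator_of_notMem hi _)).symm
  simp_rw [h1]
  rw [lintegral_prod_eq_prod_lintegral_of_indepFun Finset.univ
    (fun i (x : ι → ℝ) => (B i).indicator (fun y => ENNReal.ofReal (Real.exp (2 * s * y))) (x i))
    (iIndepFun_pi (μ := fun _ : ι => gaussianReal (-s) 1) fun i => (hm i).aemeasurable)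
    fun i => (hm i).comp (measurable_pi_apply i)]
  refine Finset.prod_congr rfl fun i _ => ?_
  rw [(measurePreserving_eval (fun _ : ι => gaussianReal (-s) 1) i).lintegral_comp (hm i),
    lintegral_indicator (hB i), ← withDensity_apply _ (hB i), ← gaussianReal_eq_withDensity_neg]

theorem map_sum_pi_gaussianReal (ι : Type*) [Fintype ι] (s : ℝ) :
    (Measure.pi (fun _ : ι => gaussianReal s 1)).map (fun x => ∑ i, x i)
      = gaussianReal (Fintype.card ι * s) (Fintype.card ι) := by
  refine Measure.ext_of_charFun ?_
  ext t
  rw [charFun_map_sum_pi_eq_prod]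
  rw [Finset.prod_const, Finset.card_univ, Pi.pow_apply, charFun_gaussianReal,
    charFun_gaussianReal, ← Complex.exp_nat_mul]
  congr 1
  push_cast
  ring

theorem pi_gaussianReal_real_sum_nonpos {ι : Type*} [Fintype ι] [Nonempty ι] (s : ℝ) :
    (Measure.pi (fun _ : ι => gaussianReal s 1)).real {x | ∑ i, x i ≤ 0}
      = 1 - cdf (gaussianReal 0 1) (s * √(Fintype.card ι)) := by
  have hn : (0 : ℝ) < Fintype.card ι := by exact_mod_cast Fintype.card_pos
  have h1 : (gaussianReal 0 1).map (fun x => √(Fintype.card ι) * x + Fintype.card ι * s)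
      = gaussianReal (Fintype.card ι * s) (Fintype.card ι) := by
    have : (fun x : ℝ => √(Fintype.card ι) * x + Fintype.card ι * s)
      = (fun x => x + Fintype.card ι * s) ∘ (fun x => √(Fintype.card ι) * x) := rfl
    rw [this, ← Measure.map_map (by fun_prop) (by fun_prop), gaussianReal_map_const_mul,
      gaussianReal_map_add_const]
    congr 1
    · ring
    · ext; simp
  have h2 : {x : ι → ℝ | ∑ i, x i ≤ 0} = (fun x => ∑ i, x i) ⁻¹' Set.Iic 0 := rfl
  rw [h2, ← map_measureReal_apply (by fun_prop) measurableSet_Iic, map_sum_pi_gaussianReal, ← h1,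
    map_measureReal_apply (by fun_prop) measurableSet_Iic, ← cdf_gaussianReal_neg, cdf_eq_real]
  congr 1
  ext x
  have h3 : √(Fintype.card ι : ℝ) * √(Fintype.card ι) = Fintype.card ι :=
    Real.mul_self_sqrt hn.le
  have h4 : √(Fintype.card ι : ℝ) * x + Fintype.card ι * s
      = √(Fintype.card ι) * (x + s * √(Fintype.card ι)) := by
    nth_rewrite 2 [← h3]
    ring
  simp only [Set.mem_preimage, Set.mem_Iic]
  rw [h4, mul_nonpos_iff_pos_imp_nonpos]
  have h5 : 0 < √(Fintype.card ι : ℝ) := Real.sqrt_pos.2 hn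
  constructor
  · intro h
    linarith [h.1 h5]
  · exact fun h => ⟨fun _ => by linarith, fun h' => h5.le⟩

theorem pi_gaussianReal_real_sum_pos {ι : Type*} [Fintype ι] [Nonempty ι] (s : ℝ) :
    (Measure.pi (fun _ : ι => gaussianReal (-s) 1)).real {x | 0 < ∑ i, x i}
      = 1 - cdf (gaussianReal 0 1) (s * √(Fintype.card ι)) := by
  have h1 : {x : ι → ℝ | 0 < ∑ i, x i} = {x | ∑ i, x i ≤ 0}ᶜ := by ext; simp
  have h2 := pi_gaussianReal_real_sum_nonpos (ι := ι) (-s)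
  rw [h1, probReal_compl_eq_one_sub (measurableSet_le (by fun_prop) measurable_const), h2,
    neg_mul, cdf_gaussianReal_neg]
  ring

/-- Neyman–Pearson: the likelihood ratio `exp(2s ∑ xᵢ)` is at most `1` on `H = {∑ xᵢ ≤ 0}` and at
least `1` off it. Exchanging the two measures on `F ∩ H` and on `E ∩ Hᶜ` therefore only lowers the
sum, leaving the errors of the test `H`. -/
theorem two_mul_one_sub_cdf_le {ι : Type*} [Fintype ι] [Nonempty ι] {s : ℝ} (hs : 0 ≤ s)
    {E F : Set (ι → ℝ)} (hE : MeasurableSet E) (hF : MeasurableSet F) (hEF : E ∪ F = Set.univ) :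
    2 * (1 - cdf (gaussianReal 0 1) (s * √(Fintype.card ι)))
      ≤ (Measure.pi fun _ : ι => gaussianReal s 1).real E
        + (Measure.pi fun _ : ι => gaussianReal (-s) 1).real F := by
  have hH : MeasurableSet {x : ι → ℝ | ∑ i, x i ≤ 0} :=
    measurableSet_le (by fun_prop) measurable_const
  set H := {x : ι → ℝ | ∑ i, x i ≤ 0} with hHdef
  set Q := Measure.pi fun _ : ι => gaussianReal s 1
  set R := Measure.pi fun _ : ι => gaussianReal (-s) 1
  have hQR : Q = R.withDensity fun x => ENNReal.ofReal (Real.exp (2 * s * ∑ i, x i)) :=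
    pi_gaussianReal_eq_withDensity_neg ι s
  have h1 : Q.real (F ∩ H) ≤ R.real (F ∩ H) := by
    refine ENNReal.toReal_mono (measure_ne_top _ _) ?_
    rw [hQR, withDensity_apply _ (hF.inter hH)]
    calc _ ≤ lintegral (R.restrict (F ∩ H)) (fun _ => 1) := by
          refine setLIntegral_mono measurable_const fun x hx => ?_
          rw [ENNReal.ofReal_le_one, Real.exp_le_one_iff]
          exact mul_nonpos_of_nonneg_of_nonpos (by positivity) hx.2
      _ = _ := by simp
  have h2 : R.real (E ∩ Hᶜ) ≤ Q.real (E ∩ Hᶜ) := by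
    refine ENNReal.toReal_mono (measure_ne_top _ _) ?_
    rw [hQR, withDensity_apply _ (hE.inter hH.compl)]
    calc R (E ∩ Hᶜ) = lintegral (R.restrict (E ∩ Hᶜ)) (fun _ => 1) := by simp
      _ ≤ _ := by
          refine setLIntegral_mono (by fun_prop) fun x hx => ?_
          rw [ENNReal.one_le_ofReal, Real.one_le_exp_iff]
          exact mul_nonneg (by positivity) (not_le.1 fun h => hx.2 h).le
  have h3 : Q.real H ≤ Q.real (E ∩ H) + Q.real (F ∩ H) := by
    refine (measureReal_mono ?_).trans (measureReal_union_le _ _)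
    rw [← Set.union_inter_distrib_right, hEF, Set.univ_inter]
  have h4 : R.real Hᶜ ≤ R.real (E ∩ Hᶜ) + R.real (F ∩ Hᶜ) := by
    refine (measureReal_mono ?_).trans (measureReal_union_le _ _)
    rw [← Set.union_inter_distrib_right, hEF, Set.univ_inter]
  have h5 := measureReal_inter_add_sdiff (μ := Q) (s := E) hH
  have h6 := measureReal_inter_add_sdiff (μ := R) (s := F) hH
  have h7 : Q.real H = _ := pi_gaussianReal_real_sum_nonpos s
  have h8 : R.real Hᶜ = 1 - cdf (gaussianReal 0 1) (s * √(Fintype.card ι)) := by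
    have : Hᶜ = {x : ι → ℝ | 0 < ∑ i, x i} := by ext; simp [hHdef]
    rw [this]
    exact pi_gaussianReal_real_sum_pos s
  rw [Set.sdiff_eq] at h5 h6
  linarith

/-- The law is a degenerate Gaussian with covariance `z zᵀ ⪯ Θ`. Being carried by a line, it reduces
the lower bound to a scalar problem. -/
theorem isSubGaussian_map_gaussianReal {d : ℕ} {θ z : Fin d → ℝ} {Θ : Matrix (Fin d) (Fin d) ℝ}
    (s : ℝ) (hz : ∀ f : Fin d → ℝ, (f ⬝ᵥ z) ^ 2 ≤ f ⬝ᵥ (Θ *ᵥ f)) :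
    IsSubGaussian (θ + s • z) Θ ((gaussianReal s 1).map fun x => θ + x • z) := by
  have hm : Measurable fun x : ℝ => θ + x • z := by fun_prop
  refine ⟨Measure.isProbabilityMeasure_map hm.aemeasurable, fun f => ?_⟩
  have hfun : (fun x : ℝ => Real.exp (f ⬝ᵥ (θ + x • z)))
      = fun x => Real.exp (f ⬝ᵥ θ) * Real.exp ((f ⬝ᵥ z) * x) := by
    ext x
    rw [← Real.exp_add, dotProduct_add, dotProduct_smul, smul_eq_mul, mul_comm x]
  have hexp : Measurable fun ζ : Fin d → ℝ => Real.exp (f ⬝ᵥ ζ) := by fun_prop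
  constructor
  · rw [integrable_map_measure hexp.aestronglyMeasurable hm.aemeasurable]
    change Integrable (fun x : ℝ => Real.exp (f ⬝ᵥ (θ + x • z))) _
    rw [hfun]
    exact (integrable_exp_mul_gaussianReal _).const_mul _
  · rw [integral_map hm.aemeasurable hexp.aestronglyMeasurable, hfun, integral_const_mul]
    have h1 := congrFun (mgf_id_gaussianReal (μ := s) (v := 1)) (f ⬝ᵥ z)
    simp only [mgf, id] at h1
    rw [h1, ← Real.exp_add, Real.log_exp, dotProduct_add, dotProduct_smul, smul_eq_mul]
    have := hz f
    push_cast
    linarith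

section Saddle

/-! ### Solvability and the saddle point -/

theorem exists_eq_conjTranspose_mul_self {d : ℕ} {Θ : Matrix (Fin d) (Fin d) ℝ}
    (hΘ : Θ.PosSemidef) : ∃ B : Matrix (Fin d) (Fin d) ℝ, Θ = Bᴴ * B := by
  open scoped MatrixOrder in
  exact CStarAlgebra.nonneg_iff_eq_star_mul_self.mp hΘ.nonneg

theorem dotProduct_conjTranspose_mul_self_mulVec {d : ℕ} (B : Matrix (Fin d) (Fin d) ℝ)
    (f : Fin d → ℝ) : f ⬝ᵥ ((Bᴴ * B) *ᵥ f) = ‖WithLp.toLp 2 (B *ᵥ f)‖ ^ 2 := by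
  rw [EuclideanSpace.norm_sq_eq, ← mulVec_mulVec, dotProduct_mulVec,
    conjTranspose_eq_transpose_of_trivial, vecMul_transpose, dotProduct]
  exact Finset.sum_congr rfl fun i _ => by simp [sq]

theorem convexOn_sqrt_quadratic {d : ℕ} {Θ : Matrix (Fin d) (Fin d) ℝ} (hΘ : Θ.PosSemidef)
    {C : ℝ} (hC : 0 ≤ C) :
    ConvexOn ℝ Set.univ fun f : Fin d → ℝ => √(C * (f ⬝ᵥ (Θ *ᵥ f))) := by
  obtain ⟨B, rfl⟩ := exists_eq_conjTranspose_mul_self hΘ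
  let T : (Fin d → ℝ) →ₗ[ℝ] EuclideanSpace ℝ (Fin d) :=
    (WithLp.linearEquiv 2 ℝ (Fin d → ℝ)).symm.toLinearMap ∘ₗ B.mulVecLin
  have hT (f : Fin d → ℝ) : √(C * (f ⬝ᵥ ((Bᴴ * B) *ᵥ f))) = √C * ‖T f‖ := by
    rw [dotProduct_conjTranspose_mul_self_mulVec, Real.sqrt_mul hC, Real.sqrt_sq (norm_nonneg _)]
    rfl
  simp_rw [hT]
  exact ((convexOn_norm convex_univ).comp_linearMap T).smul (Real.sqrt_nonneg C)

/-- Source of coercivity: a square factor of `Θ` is injective, hence antilipschitz. -/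
theorem exists_norm_le_mul_sqrt_quadratic {d : ℕ} {Θ : Matrix (Fin d) (Fin d) ℝ}
    (hΘ : Θ.PosDef) {C : ℝ} (hC : 0 < C) :
    ∃ k : ℝ, ∀ f : Fin d → ℝ, ‖f‖ ≤ k * √(C * (f ⬝ᵥ (Θ *ᵥ f))) := by
  obtain ⟨B, rfl⟩ := exists_eq_conjTranspose_mul_self hΘ.posSemidef
  let T : (Fin d → ℝ) →ₗ[ℝ] EuclideanSpace ℝ (Fin d) :=
    (WithLp.linearEquiv 2 ℝ (Fin d → ℝ)).symm.toLinearMap ∘ₗ B.mulVecLin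
  have hT (f : Fin d → ℝ) : f ⬝ᵥ ((Bᴴ * B) *ᵥ f) = ‖T f‖ ^ 2 :=
    dotProduct_conjTranspose_mul_self_mulVec B f
  have hker : LinearMap.ker T = ⊥ := by
    refine LinearMap.ker_eq_bot'.2 fun f hf => ?_
    by_contra h
    have h1 := hΘ.dotProduct_mulVec_pos h
    rw [star_trivial, hT, hf] at h1
    simp at h1
  obtain ⟨k, -, hk⟩ := T.exists_antilipschitzWith hker
  refine ⟨k / √C, fun f => ?_⟩
  have h1 := hk.le_mul_dist f 0
  rw [map_zero, dist_zero_right, dist_zero_right] at h1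
  rw [hT, Real.sqrt_mul hC.le, Real.sqrt_sq (norm_nonneg _), ← mul_assoc,
    div_mul_cancel₀ _ (Real.sqrt_pos.2 hC).ne']
  exact h1

/-- If every `y` admits an `x` in a convex compact set with `c ≤ F y x`, where `F` is convex in `y`
and concave in `x`, then some `x` serves all `y` simultaneously. -/
theorem exists_forall_le_of_forall_exists_le {E G : Type*} [NormedAddCommGroup E] [NormedSpace ℝ E]
    [NormedAddCommGroup G] [NormedSpace ℝ G] {X : Set E} (hne : X.Nonempty)
    (hconv : Convex ℝ X) (hcomp : IsCompact X) {F : G → E → ℝ}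
    (hF : Continuous fun p : G × E => F p.1 p.2)
    (hF1 : ∀ x ∈ X, ConvexOn ℝ Set.univ fun y => F y x)
    (hF2 : ∀ y, ConcaveOn ℝ X (F y)) {c : ℝ} (h : ∀ y, ∃ x ∈ X, c ≤ F y x) :
    ∃ x ∈ X, ∀ y, c ≤ F y x := by
  have hFx (y : G) : Continuous fun x => -F y x :=
    (hF.comp (by fun_prop : Continuous fun x => (y, x))).neg
  have hFy (x : E) : Continuous fun y => -F y x :=
    (hF.comp (by fun_prop : Continuous fun y => (y, x))).neg
  have hlsc : ∀ y ∈ (Set.univ : Set G), LowerSemicontinuousOn (fun x => -F y x) X :=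
    fun y _ => (hFx y).lowerSemicontinuous.lowerSemicontinuousOn _
  by_contra! hcon
  -- By compactness, finitely many `y` already exclude every `x`. Sion's argument for `-F` merges
  -- them into a single `y` excluding every `x`, against `h`.
  obtain ⟨s, hs⟩ := (LowerSemicontinuousOn.inter_biInter_preimage_Iic_eq_empty_iff_exists_finset
    (c := -c) hcomp hlsc).1 (by
      refine Set.eq_empty_of_forall_notMem fun x hx => ?_
      obtain ⟨y, hy⟩ := hcon x hx.1
      have h1 := Set.mem_iInter₂.1 hx.2 y trivial
      simp only [Set.mem_preimage, Set.mem_Iic] at h1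
      linarith)
  obtain ⟨y, -, hy⟩ := Sion.exists_lt_iInf_of_lt_iInf_of_finite (Y := Set.univ)
    (f := fun x y => -F y x) hne hcomp hlsc
    (fun y _ => (hF2 y).neg.quasiconvexOn) convex_univ
    (fun x _ => (hFy x).upperSemicontinuous.upperSemicontinuousOn _)
    (fun x hx => (hF1 x hx).neg.quasiconcaveOn) hconv
    (s := Subtype.val '' (s : Set (Set.univ : Set G))) (s.finite_toSet.image _)
    (Set.subset_univ _) (t := -c) (fun x hx => by
      obtain ⟨i, hi, hlt⟩ := hs x hx
      exact ⟨i, ⟨i, hi, rfl⟩, hlt⟩)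
  obtain ⟨x, hx, hle⟩ := h y
  linarith [hy x hx]

/-- The convex-concave function whose maximum over `U × U × V` is the objective. -/
noncomputable def payoff {d nu nv : ℕ} (A : Matrix (Fin d) (Fin nu) ℝ)
    (M : (Fin nv → ℝ) →ᵃ[ℝ] Matrix (Fin d) (Fin d) ℝ) (g : Fin nu → ℝ) (C : ℝ) (f : Fin d → ℝ)
    (x : (Fin nu → ℝ) × (Fin nu → ℝ) × (Fin nv → ℝ)) : ℝ :=
  (1 / 2) * ((x.1 - x.2.1) ⬝ᵥ (Aᵀ *ᵥ f - g)) + √(C * (f ⬝ᵥ (M x.2.2 *ᵥ f)))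

variable {K d nu nv : ℕ} {U : Set (Fin nu → ℝ)} {V : Set (Fin nv → ℝ)}
  {A : Matrix (Fin d) (Fin nu) ℝ} {M : (Fin nv → ℝ) →ᵃ[ℝ] Matrix (Fin d) (Fin d) ℝ}
  {g : Fin nu → ℝ} {ε C : ℝ}

theorem continuous_payoff : Continuous fun p : (Fin d → ℝ) ×
    (Fin nu → ℝ) × (Fin nu → ℝ) × (Fin nv → ℝ) => payoff A M g C p.1 p.2 := by
  unfold payoff
  refine Continuous.add (by fun_prop) ?_
  exact (continuous_stdDev M C).comp (by fun_prop :
    Continuous fun p : (Fin d → ℝ) × (Fin nu → ℝ) × (Fin nu → ℝ) × (Fin nv → ℝ) =>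
      (p.1, p.2.2.2))

theorem isGreatest_payoff (hUne : U.Nonempty) (hU : IsCompact U) (hVne : V.Nonempty)
    (hV : IsCompact V) (f : Fin d → ℝ) :
    IsGreatest (payoff A M g (2 * (K : ℝ)⁻¹ * Real.log (2 / ε)) f '' (U ×ˢ U ×ˢ V))
      (objective K U V A M g ε f) := by
  have hneg (u : Fin nu → ℝ) : u ⬝ᵥ (-(Aᵀ *ᵥ f) + g) = -(u ⬝ᵥ (Aᵀ *ᵥ f - g)) := by
    rw [← dotProduct_neg, neg_sub, neg_add_eq_sub]
  constructor
  · obtain ⟨u₁, h₁, e₁⟩ := exists_dotProduct_eq_supportFn hU hUne (Aᵀ *ᵥ f - g)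
    obtain ⟨u₂, h₂, e₂⟩ := exists_dotProduct_eq_supportFn hU hUne (-(Aᵀ *ᵥ f) + g)
    obtain ⟨v, hv, ev⟩ := (hV.image (f := fun v =>
      √(2 * (K : ℝ)⁻¹ * Real.log (2 / ε) * (f ⬝ᵥ (M v *ᵥ f))))
        ((continuous_stdDev M _).comp (by fun_prop : Continuous fun v => (f, v)))).sSup_mem
          (hVne.image _)
    refine ⟨(u₁, u₂, v), ⟨h₁, h₂, hv⟩, ?_⟩
    simp only at ev
    rw [payoff, objective, ← ev, ← e₁, ← e₂, hneg, sub_dotProduct]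
    ring
  · rintro _ ⟨⟨u₁, u₂, v⟩, ⟨h₁, h₂, hv⟩, rfl⟩
    have e₁ := dotProduct_le_supportFn hU h₁ (Aᵀ *ᵥ f - g)
    have e₂ := dotProduct_le_supportFn hU h₂ (-(Aᵀ *ᵥ f) + g)
    have e₃ := stdDev_le_sSup (M := M) hV hv (2 * (K : ℝ)⁻¹ * Real.log (2 / ε)) f
    rw [hneg] at e₂
    simp only at h₁ h₂ hv
    rw [payoff, objective, sub_dotProduct]
    linarith

theorem convexOn_payoff {x : (Fin nu → ℝ) × (Fin nu → ℝ) × (Fin nv → ℝ)}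
    (hx : (M x.2.2).PosSemidef) (hC : 0 ≤ C) :
    ConvexOn ℝ Set.univ fun f => payoff A M g C f x := by
  unfold payoff
  refine ConvexOn.add ⟨convex_univ, fun f _ h _ a b _ _ hab => le_of_eq ?_⟩
    (convexOn_sqrt_quadratic hx hC)
  simp only [mulVec_add, mulVec_smul, dotProduct_sub, dotProduct_add, dotProduct_smul, smul_eq_mul]
  linear_combination (1 / 2) * ((x.1 - x.2.1) ⬝ᵥ g) * (hab)

/-- Affinity of `M` enters here: the square root of a nonnegative affine function of `v` is concave.
-/
theorem concaveOn_payoff (hUc : Convex ℝ U) (hVc : Convex ℝ V)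
    (hM : ∀ v ∈ V, (M v).PosSemidef) (hC : 0 ≤ C) (f : Fin d → ℝ) :
    ConcaveOn ℝ (U ×ˢ U ×ˢ V) (payoff A M g C f) := by
  have hconv := hUc.prod (hUc.prod hVc)
  have hnn : ∀ v ∈ V, 0 ≤ C * (f ⬝ᵥ (M v *ᵥ f)) := fun v hv =>
    mul_nonneg hC (by simpa using (hM v hv).dotProduct_mulVec_nonneg f)
  refine ConcaveOn.add ⟨hconv, fun x _ y _ a b _ _ hab => le_of_eq ?_⟩
    ⟨hconv, fun x hx y hy a b ha hb hab => ?_⟩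
  · simp only [Prod.fst_add, Prod.snd_add, Prod.smul_fst, Prod.smul_snd, sub_dotProduct,
      add_dotProduct, smul_dotProduct, smul_eq_mul]
    ring
  · have h1 := Real.strictConcaveOn_sqrt.concaveOn.2 (hnn _ hx.2.2) (hnn _ hy.2.2) ha hb hab
    refine h1.trans_eq (congrArg Real.sqrt ?_)
    rw [Prod.snd_add, Prod.snd_add, Prod.smul_snd, Prod.smul_snd, Prod.smul_snd, Prod.smul_snd,
      Convex.combo_affine_apply hab, add_mulVec, smul_mulVec, smul_mulVec, dotProduct_add,
      dotProduct_smul, dotProduct_smul]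
    simp only [smul_eq_mul]
    ring

theorem exists_objective_le (hK : 0 < K) (hUne : U.Nonempty) (hU : IsCompact U)
    (hVne : V.Nonempty) (hV : IsCompact V) (hM : ∀ v ∈ V, (M v).PosDef)
    (h0 : 0 < ε) (h1 : ε < 1) :
    ∃ f₀ : Fin d → ℝ, ∀ f, objective K U V A M g ε f₀ ≤ objective K U V A M g ε f := by
  have hL : 0 < Real.log (2 / ε) := Real.log_pos (by rw [lt_div_iff₀ h0]; linarith)
  have hK' : (0 : ℝ) < K := by exact_mod_cast hK
  have hlsc : LowerSemicontinuous (objective K U V A M g ε) := by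
    refine lowerSemicontinuous_iff_isClosed_preimage.2 fun t => ?_
    have : objective K U V A M g ε ⁻¹' Set.Iic t
        = ⋂ x ∈ U ×ˢ U ×ˢ V, {f | payoff A M g (2 * (K : ℝ)⁻¹ * Real.log (2 / ε)) f x ≤ t} := by
      ext f
      have := (isGreatest_payoff (K := K) (A := A) (M := M) (g := g) (ε := ε)
        hUne hU hVne hV f).isLUB
      simp only [Set.mem_preimage, Set.mem_Iic, Set.mem_iInter, Set.mem_ofPred_eq]
      rw [isLUB_le_iff this, mem_upperBounds, Set.forall_mem_image]
    rw [this]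
    exact isClosed_biInter fun x _ => isClosed_le
      (continuous_payoff.comp (by fun_prop : Continuous fun f => (f, x))) continuous_const
  obtain ⟨u, hu⟩ := hUne
  obtain ⟨v, hv⟩ := hVne
  obtain ⟨k, hk⟩ := exists_norm_le_mul_sqrt_quadratic (hM v hv)
    (C := 2 * (K : ℝ)⁻¹ * Real.log (2 / ε)) (by positivity)
  -- Taking `u₁ = u₂` kills the linear term, so the objective dominates a multiple of a norm and its
  -- sublevel sets are bounded.
  have hlow (f : Fin d → ℝ) : √(2 * (K : ℝ)⁻¹ * Real.log (2 / ε) * (f ⬝ᵥ (M v *ᵥ f)))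
      ≤ objective K U V A M g ε f := by
    have := (isGreatest_payoff (K := K) (A := A) (M := M) (g := g) (ε := ε) ⟨u, hu⟩ hU ⟨v, hv⟩
      hV f).2 ⟨(u, u, v), ⟨hu, hu, hv⟩, rfl⟩
    simpa [payoff] using this
  set t := objective K U V A M g ε 0
  have hcomp : IsCompact (objective K U V A M g ε ⁻¹' Set.Iic t) := by
    refine Metric.isCompact_of_isClosed_isBounded (hlsc.isClosed_preimage t) ?_
    refine isBounded_iff_forall_norm_le.2 ⟨|k| * t, fun f hf => (hk f).trans ?_⟩
    refine mul_le_mul (le_abs_self k) ((hlow f).trans hf) (Real.sqrt_nonneg _) (abs_nonneg k)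
  obtain ⟨f₀, hf₀, hmin⟩ := (hlsc.lowerSemicontinuousOn _).exists_isMinOn
    ⟨0, show objective K U V A M g ε 0 ≤ t from le_rfl⟩ hcomp
  refine ⟨f₀, fun f => ?_⟩
  by_cases hf : objective K U V A M g ε f ≤ t
  · exact hmin hf
  · exact le_trans hf₀ (not_le.1 hf).le

theorem objective_nonneg (hUne : U.Nonempty) (hU : IsCompact U)
    (hVne : V.Nonempty) (hV : IsCompact V) (f : Fin d → ℝ) :
    0 ≤ objective K U V A M g ε f := by
  obtain ⟨u, hu⟩ := id hUne
  obtain ⟨v, hv⟩ := id hVne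
  have := (isGreatest_payoff (K := K) (A := A) (M := M) (g := g) (ε := ε) hUne hU hVne
      hV f).2 ⟨(u, u, v), ⟨hu, hu, hv⟩, rfl⟩
  refine le_trans ?_ this
  simp [payoff]

theorem Opt_le_objective (hUne : U.Nonempty) (hU : IsCompact U)
    (hVne : V.Nonempty) (hV : IsCompact V) (f : Fin d → ℝ) :
    Opt K U V A M g ε ≤ objective K U V A M g ε f :=
  ciInf_le ⟨0, Set.forall_mem_range.2 fun f => objective_nonneg hUne hU hVne hV f⟩ f

theorem exists_saddle (hUne : U.Nonempty) (hUc : Convex ℝ U) (hU : IsCompact U)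
    (hVne : V.Nonempty) (hVc : Convex ℝ V) (hV : IsCompact V)
    (hM : ∀ v ∈ V, (M v).PosDef) (h0 : 0 < ε) (h1 : ε < 1) :
    ∃ x ∈ U ×ˢ U ×ˢ V, ∀ f, Opt K U V A M g ε
      ≤ payoff A M g (2 * (K : ℝ)⁻¹ * Real.log (2 / ε)) f x := by
  have hL : 0 < Real.log (2 / ε) := Real.log_pos (by rw [lt_div_iff₀ h0]; linarith)
  refine exists_forall_le_of_forall_exists_le (hUne.prod (hUne.prod hVne))
    (hUc.prod (hUc.prod hVc)) (hU.prod (hU.prod hV)) continuous_payoff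
    (fun x hx => convexOn_payoff (hM _ hx.2.2).posSemidef (by positivity))
    (concaveOn_payoff hUc hVc (fun v hv => (hM v hv).posSemidef) (by positivity)) fun f => ?_
  obtain ⟨⟨x, hx, he⟩, -⟩ := isGreatest_payoff (K := K) (A := A) (M := M) (g := g) (ε := ε)
    hUne hU hVne hV f
  exact ⟨x, hx, (Opt_le_objective hUne hU hVne hV f).trans_eq he.symm⟩

end Saddle

section NearOptimality

/-! ### Near-optimality -/

variable {K d nu nv : ℕ} {U : Set (Fin nu → ℝ)} {V : Set (Fin nv → ℝ)}
  {A : Matrix (Fin d) (Fin nu) ℝ} {M : (Fin nv → ℝ) →ᵃ[ℝ] Matrix (Fin d) (Fin d) ℝ}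
  {g : Fin nu → ℝ} {a : Fin d → ℝ} {c ε : ℝ}

/-- Two parameters `u₁, u₂` whose images under `A` differ by `2 s z` with `z zᵀ ⪯ M(v)` cannot be
distinguished at level `ε` when `s √K` is below the normal quantile, so an accurate estimate
cannot separate the values `gᵀu₁` and `gᵀu₂`. -/
theorem abs_sub_le_two_mul_of_isAccurate (hK : 0 < K) (hε : ε < 1)
    {ghat : (Fin K → Fin d → ℝ) → ℝ} (hghat : Measurable ghat) {ρ : ℝ}
    (hacc : IsAccurate U V A a M g c ε ghat ρ) {u₁ u₂ : Fin nu → ℝ} (h₁ : u₁ ∈ U) (h₂ : u₂ ∈ U)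
    {v : Fin nv → ℝ} (hv : v ∈ V) (hε0 : 0 ≤ ε) {θ z : Fin d → ℝ} {s : ℝ} (hs : 0 ≤ s)
    (hz : ∀ f : Fin d → ℝ, (f ⬝ᵥ z) ^ 2 ≤ f ⬝ᵥ (M v *ᵥ f))
    (e₁ : A *ᵥ u₁ + a = θ + s • z) (e₂ : A *ᵥ u₂ + a = θ + (-s) • z)
    (hq : s * √K < normalQuantile (1 - ε)) :
    |g ⬝ᵥ u₁ - g ⬝ᵥ u₂| ≤ 2 * ρ := by
  by_contra! hlt
  have : Nonempty (Fin K) := ⟨⟨0, hK⟩⟩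
  have hmap : Measurable fun x : ℝ => θ + x • z := by fun_prop
  have hpi : Measurable fun (x : Fin K → ℝ) i => θ + x i • z := by fun_prop
  have key (t : ℝ) (u : Fin nu → ℝ) (hu : u ∈ U) (e : A *ᵥ u + a = θ + t • z) :
      MeasurableSet {x : Fin K → ℝ | ρ < |ghat (fun i => θ + x i • z) - (g ⬝ᵥ u + c)|} ∧
      (Measure.pi fun _ : Fin K => gaussianReal t 1).real
        {x : Fin K → ℝ | ρ < |ghat (fun i => θ + x i • z) - (g ⬝ᵥ u + c)|} ≤ ε := by
    have hms : MeasurableSet {ω | ρ < |ghat ω - (g ⬝ᵥ u + c)|} :=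
      measurableSet_lt measurable_const (by fun_prop)
    refine ⟨hpi hms, ?_⟩
    have hP := isSubGaussian_map_gaussianReal (θ := θ) t hz
    rw [← e] at hP
    have hp := hP.1
    have h := hacc u hu v hv _ hP
    rw [← Measure.pi_map_pi fun _ => hmap.aemeasurable, Measure.map_apply hpi hms] at h
    exact ENNReal.toReal_le_of_le_ofReal hε0 h
  obtain ⟨hm₁, hr₁⟩ := key s u₁ h₁ e₁
  obtain ⟨hm₂, hr₂⟩ := key (-s) u₂ h₂ e₂
  -- If both errors were at most `ρ` at one observation, the two values would differ by at most
  -- `2ρ`; so the two failure events cover the space.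
  have h3 := two_mul_one_sub_cdf_le hs hm₁ hm₂ (by
    refine Set.eq_univ_of_forall fun x => ?_
    by_contra hx
    simp only [Set.mem_union, Set.mem_ofPred_eq, not_or, not_lt] at hx
    have h4 := abs_le.1 hx.1
    have h5 := abs_le.1 hx.2
    refine absurd hlt (not_lt.2 (abs_le.2 ⟨?_, ?_⟩)) <;> linarith)
  have h4 := cdf_lt_of_lt_normalQuantile (by linarith) hq
  rw [Fintype.card_fin] at h3
  linarith

/-- Along `t • f` the payoff is `t y + |t| r` plus a constant, which is bounded below only if `|y| ≤
r`. -/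
theorem sq_dotProduct_le_of_payoff_bddBelow {O C : ℝ} (hC : 0 ≤ C)
    {x : (Fin nu → ℝ) × (Fin nu → ℝ) × (Fin nv → ℝ)} (hx : (M x.2.2).PosSemidef)
    (h : ∀ f, O ≤ payoff A M g C f x) (f : Fin d → ℝ) :
    (f ⬝ᵥ (A *ᵥ ((1 / 2 : ℝ) • (x.1 - x.2.1)))) ^ 2 ≤ C * (f ⬝ᵥ (M x.2.2 *ᵥ f)) := by
  have hnn : 0 ≤ C * (f ⬝ᵥ (M x.2.2 *ᵥ f)) :=
    mul_nonneg hC (by simpa using hx.dotProduct_mulVec_nonneg f)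
  have hray (t : ℝ) : O ≤ t * (f ⬝ᵥ (A *ᵥ ((1 / 2 : ℝ) • (x.1 - x.2.1))))
      + |t| * √(C * (f ⬝ᵥ (M x.2.2 *ᵥ f))) - (1 / 2) * ((x.1 - x.2.1) ⬝ᵥ g) := by
    refine (h (t • f)).trans_eq ?_
    have e1 : (x.1 - x.2.1) ⬝ᵥ (Aᵀ *ᵥ f) = f ⬝ᵥ (A *ᵥ (x.1 - x.2.1)) := by
      rw [mulVec_transpose, dotProduct_comm, ← dotProduct_mulVec]
    have e2 : C * ((t • f) ⬝ᵥ (M x.2.2 *ᵥ (t • f))) = t ^ 2 * (C * (f ⬝ᵥ (M x.2.2 *ᵥ f))) := by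
      rw [mulVec_smul, smul_dotProduct, dotProduct_smul, smul_eq_mul, smul_eq_mul]
      ring
    rw [payoff, e2, Real.sqrt_mul (sq_nonneg t), Real.sqrt_sq_eq_abs, mulVec_smul, dotProduct_sub,
      dotProduct_smul, e1, mulVec_smul, dotProduct_smul, smul_eq_mul, smul_eq_mul]
    ring
  set y := f ⬝ᵥ (A *ᵥ ((1 / 2 : ℝ) • (x.1 - x.2.1)))
  set r := √(C * (f ⬝ᵥ (M x.2.2 *ᵥ f)))
  set b := (1 / 2) * ((x.1 - x.2.1) ⬝ᵥ g)
  have habs : |y| ≤ r := by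
    by_contra! hlt
    have hpos : 0 < |y| - r := sub_pos.2 hlt
    -- far along the ray on which `t * y = -|t| * |y|` the payoff drops below `O`
    obtain ⟨t, ht0, ht⟩ : ∃ t : ℝ, 0 ≤ t ∧ -b - O < t * (|y| - r) :=
      ⟨(|(-b - O)| + 1) / (|y| - r), by positivity, by
        rw [div_mul_cancel₀ _ hpos.ne']
        linarith [le_abs_self (-b - O)]⟩
    have h1 := hray t
    have h2 := hray (-t)
    rw [abs_neg] at h2
    rw [abs_of_nonneg ht0] at h1 h2
    rcases abs_cases y with ⟨hy, -⟩ | ⟨hy, -⟩ <;> rw [hy] at ht <;> linarith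
  rw [← sq_abs, ← Real.sq_sqrt hnn]
  gcongr

theorem normalQuantile_mul_Opt_le (hK : 0 < K) (hUne : U.Nonempty) (hUc : Convex ℝ U)
    (hU : IsCompact U) (hVne : V.Nonempty) (hVc : Convex ℝ V) (hV : IsCompact V)
    (hM : ∀ v ∈ V, (M v).PosDef) (h0 : 0 < ε) (h1 : ε < 1 / 2)
    {ghat : (Fin K → Fin d → ℝ) → ℝ} (hghat : Measurable ghat) {ρ : ℝ}
    (hacc : IsAccurate U V A a M g c ε ghat ρ) :
    normalQuantile (1 - ε) / √(2 * Real.log (2 / ε)) * Opt K U V A M g ε ≤ ρ := by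
  have hL : 0 < Real.log (2 / ε) := Real.log_pos (by rw [lt_div_iff₀ h0]; linarith)
  have hK' : (0 : ℝ) < K := by exact_mod_cast hK
  have hS : 0 < √(2 * Real.log (2 / ε)) := Real.sqrt_pos.2 (by positivity)
  have hq := normalQuantile_pos h0 h1
  set S := √(2 * Real.log (2 / ε))
  set q := normalQuantile (1 - ε)
  set O := Opt K U V A M g ε
  -- This forces `t ≤ 1` below, so the shrunken endpoints stay on the segment `[u₁, u₂]`, inside
  -- `U`.
  have hqS : q ≤ S := by
    refine (normalQuantile_one_sub_le h0 (by linarith)).trans (Real.sqrt_le_sqrt ?_)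
    gcongr
    norm_num
  obtain ⟨⟨u₁, u₂, v⟩, ⟨hu₁, hu₂, hv⟩, hsad⟩ :=
    exists_saddle (K := K) (A := A) (g := g) hUne hUc hU hVne hVc hV hM h0 (by linarith)
  dsimp only at hu₁ hu₂ hv
  have hCpos : 0 < 2 * (K : ℝ)⁻¹ * Real.log (2 / ε) := by positivity
  have hsq := sq_dotProduct_le_of_payoff_bddBelow hCpos.le (hM v hv).posSemidef hsad
  have hgap : O ≤ -((1 / 2) * ((u₁ - u₂) ⬝ᵥ g)) := by
    refine (hsad 0).trans_eq ?_
    simp only [payoff, mulVec_zero, zero_sub, dotProduct_neg, zero_dotProduct, mul_zero,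
      Real.sqrt_zero, add_zero, mul_neg]
  dsimp only at hsq
  set w : Fin nu → ℝ := (1 / 2 : ℝ) • (u₁ - u₂) with hw
  set γ := √(2 * (K : ℝ)⁻¹ * Real.log (2 / ε)) with hγ
  have hγ0 : 0 < γ := Real.sqrt_pos.2 hCpos
  have hγ2 : γ ^ 2 = 2 * (K : ℝ)⁻¹ * Real.log (2 / ε) := Real.sq_sqrt hCpos.le
  have hγK : γ * √K = S := by
    rw [hγ, ← Real.sqrt_mul hCpos.le]
    congr 1
    field_simp
  have hz (f : Fin d → ℝ) : (f ⬝ᵥ (γ⁻¹ • (A *ᵥ w))) ^ 2 ≤ f ⬝ᵥ (M v *ᵥ f) := by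
    rw [dotProduct_smul, smul_eq_mul, mul_pow, inv_pow, inv_mul_le_iff₀ (by positivity), hγ2]
    exact hsq f
  have hstep (t : ℝ) (ht0 : 0 ≤ t) (ht : t < q / S) : t * O ≤ ρ := by
    have htS : t * S < q := (lt_div_iff₀ hS).1 ht
    have ht1 : t ≤ 1 := ht.le.trans ((div_le_one hS).2 hqS)
    have hAw : (t * γ) • (γ⁻¹ • (A *ᵥ w)) = t • (A *ᵥ w) := by
      rw [smul_smul, mul_assoc, mul_inv_cancel₀ hγ0.ne', mul_one]
    have hmem₁ : (1 / 2 : ℝ) • (u₁ + u₂) + t • w ∈ U := by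
      have := hUc hu₁ hu₂ (a := (1 + t) / 2) (b := (1 - t) / 2) (by linarith) (by linarith)
        (by ring)
      convert this using 1
      rw [hw]
      module
    have hmem₂ : (1 / 2 : ℝ) • (u₁ + u₂) - t • w ∈ U := by
      have := hUc hu₁ hu₂ (a := (1 - t) / 2) (b := (1 + t) / 2) (by linarith) (by linarith)
        (by ring)
      convert this using 1
      rw [hw]
      module
    have hmain := abs_sub_le_two_mul_of_isAccurate hK (by linarith) hghat hacc hmem₁ hmem₂ hv h0.le
      (θ := A *ᵥ ((1 / 2 : ℝ) • (u₁ + u₂)) + a) (s := t * γ) (by positivity) hz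
      (by rw [hAw, mulVec_add, mulVec_smul A t w]; abel)
      (by rw [neg_smul, hAw, mulVec_sub, mulVec_smul A t w]; abel)
      (by rw [mul_assoc, hγK]; exact htS)
    rw [← dotProduct_sub, add_sub_sub_cancel, ← two_smul ℝ (t • w), dotProduct_smul,
      dotProduct_smul, hw, dotProduct_smul, dotProduct_comm] at hmain
    simp only [smul_eq_mul] at hmain
    have h5 := (neg_le_abs _).trans hmain
    nlinarith [mul_le_mul_of_nonneg_left hgap ht0]
  -- Indistinguishability needs `t` strictly below `q / S`; the endpoint is reached in the limit.
  have hcont : Tendsto (fun t : ℝ => t * O) (𝓝[<] (q / S)) (𝓝 (q / S * O)) :=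
    ((continuous_id.mul continuous_const).tendsto (q / S)).mono_left nhdsWithin_le_nhds
  refine le_of_tendsto hcont ?_
  filter_upwards [Ioo_mem_nhdsLT (div_pos hq hS)] with t ht using hstep t ht.1.le ht.2

theorem Opt_le_nearOptFactor_mul_minimaxRisk (hK : 0 < K) (hUne : U.Nonempty) (hUc : Convex ℝ U)
    (hU : IsCompact U) (hVne : V.Nonempty) (hVc : Convex ℝ V) (hV : IsCompact V)
    (hM : ∀ v ∈ V, (M v).PosDef) (h0 : 0 < ε) (h1 : ε < 1 / 2) :
    ((Opt K U V A M g ε : ℝ) : EReal)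
      ≤ ((nearOptFactor ε : ℝ) : EReal) * minimaxRisk K U V A a M g c ε := by
  have hL : 0 < Real.log (2 / ε) := Real.log_pos (by rw [lt_div_iff₀ h0]; linarith)
  have hS : 0 < √(2 * Real.log (2 / ε)) := Real.sqrt_pos.2 (by positivity)
  have hq := normalQuantile_pos h0 h1
  have hle : ((normalQuantile (1 - ε) / √(2 * Real.log (2 / ε)) * Opt K U V A M g ε : ℝ) : EReal)
      ≤ minimaxRisk K U V A a M g c ε :=
    le_iInf₂ fun ghat hghat => le_iInf₂ fun ρ hρ => EReal.coe_le_coe_iff.2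
      (normalQuantile_mul_Opt_le hK hUne hUc hU hVne hVc hV hM h0 h1 hghat hρ)
  have hF : 0 ≤ nearOptFactor ε := div_nonneg hS.le hq.le
  refine le_trans (le_of_eq ?_) (mul_le_mul_of_nonneg_left hle (EReal.coe_nonneg.2 hF))
  rw [← EReal.coe_mul, nearOptFactor]
  congr 1
  field_simp

end NearOptimality

end LinearFormRecovery

open LinearFormRecovery
theorem proposition4p2 :
    (∀ (K d nu nv : ℕ) (_ : 0 < K) (_ : 0 < d)
      (U : Set (Fin nu → ℝ)) (_ : U.Nonempty) (_ : Convex ℝ U) (_ : IsCompact U)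
      (V : Set (Fin nv → ℝ)) (_ : V.Nonempty) (_ : Convex ℝ V) (_ : IsCompact V)
      (A : Matrix (Fin d) (Fin nu) ℝ) (a : Fin d → ℝ)
      (M : (Fin nv → ℝ) →ᵃ[ℝ] Matrix (Fin d) (Fin d) ℝ) (_ : ∀ v ∈ V, (M v).PosDef)
      (g : Fin nu → ℝ) (c ε : ℝ) (_ : 0 < ε) (_ : ε < 1),
      -- the problem defining `Opt` is solvable
      (∃ f : Fin d → ℝ, objective K U V A M g ε f = Opt K U V A M g ε) ∧
      -- `Opt` bounds the risk of the affine estimate yielded by any optimal solution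
      (∀ f : Fin d → ℝ, objective K U V A M g ε f = Opt K U V A M g ε →
        epsRisk (K := K) U V A a M g c ε (affineEstimate U A a g c f)
          ≤ ((Opt K U V A M g ε : ℝ) : EReal)) ∧
      -- near-optimality
      (ε < 1 / 2 →
        ((Opt K U V A M g ε : ℝ) : EReal)
          ≤ ((nearOptFactor ε : ℝ) : EReal) * minimaxRisk K U V A a M g c ε)) ∧
    Tendsto nearOptFactor (𝓝[>] 0) (𝓝 1) := by
  refine ⟨?_, tendsto_nearOptFactor⟩
  intro K d nu nv hK _ U hUne hUc hU V hVne hVc hV A a M hM g c ε h0 h1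
  refine ⟨?_, fun f hf => hf ▸ epsRisk_affineEstimate_le hK hU hV hM a c h0 h1 f, fun h2 =>
    Opt_le_nearOptFactor_mul_minimaxRisk hK hUne hUc hU hVne hVc hV hM h0 h2⟩
  obtain ⟨f₀, hf₀⟩ := exists_objective_le (A := A) (g := g) hK hUne hU hVne hV hM h0 h1
  exact ⟨f₀, le_antisymm (le_ciInf hf₀) (Opt_le_objective hUne hU hVne hV f₀)⟩
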